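/- A \emph{convex combination space} is a metric space $(X,d)$ with an operation that assigns to all $n\ge 1$, all $\lambda_1,\dots,\lambda_n>0$ with $\sum_i\lambda_i=1$ and all $u_1,\dots,u_n\in X$ an element $[\lambda_1,u_1;\dots;\lambda_n,u_n]=[\lambda_i,u_i]_{i=1}^n$ of $X$, such that $[1,u]=u$ for all $u\in X$ and: (i) $[\lambda_i,u_i]_{i=1}^n=[\lambda_{\sigma(i)},u_{\sigma(i)}]_{i=1}^n$ for every permutation $\sigma$ of $\{1,\dots,n\}$; (ii) $[\lambda_i,u_i]_{i=1}^{n+2}=\bigl[\lambda_1,u_1;\dots;\lambda_n,u_n;\lambda_{n+1}+\lambda_{n+2},\bigl[\tfrac{\lambda_{n+j}}{\lambda_{n+1}+\lambda_{n+2}},u_{n+j}\bigr]_{j=1}^2\bigr]$; (iii) if $\lambda^{(k)}\in(0,1)$ and $\lambda^{(k)}\to\lambda\in(0,1)$, then $[\lambda^{(k)},u;1-\lambda^{(k)},v]\to[\lambda,u;1-\lambda,v]$ for all $u,v\in X$; (iv) $d([\lambda,u_1;1-\lambda,u_2],[\lambda,v_1;1-\lambda,v_2])\le\lambda d(u_1,v_1)+(1-\lambda)d(u_2,v_2)$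 for all $u_1,u_2,v_1,v_2\in X$ and $\lambda\in(0,1)$; (v) for each $u\in X$ the limit $Ku:=\lim_{n\to\infty}[n^{-1},u]_{i=1}^n$ exists in $X$. The space is called \emph{convexifiable} if $K(X)=X$ (equivalently, $Ku=u$ for every $u\in X$). One puts $[1,x;0,y]:=x$ and $[0,x;1,y]:=y$. \textbf{Theorem.} Let $(X,d,[\cdot,\cdot])$ be a complete and convexifiable convex combination space. Then there exist a real Banach space $(E,\|\cdot\|)$ and an injective map $j\colon X\to E$ such that (1) $j(X)$ is a closed and convex subset of $E$; (2) $j([\lambda,x;1-\lambda,y])=\lambda j(x)+(1-\lambda)j(y)$ for all $x,y\in X$ and $\lambda\in[0,1]$; (3) $d(x,y)=\|j(x)-j(y)\|$ for all $x,y\in X$. Moreover, $E$ can be chosen so that, if $X$ is separable, then $E$ is separable. -/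

import Mathlib

universe u

/-- Tuples `(λ₁, …, λₙ)` of strictly positive reals with sum `1` (there are none for `n = 0`). -/
structure PosWeights (n : ℕ) where
  val : Fin n → ℝ
  pos : ∀ i, 0 < val i
  sum_eq_one : ∑ i, val i = 1

namespace PosWeights

/-- The permuted weights `(λ_{σ(1)}, …, λ_{σ(n)})`. -/
def perm {n : ℕ} (w : PosWeights n) (σ : Equiv.Perm (Fin n)) : PosWeights n where
  val := fun i => w.val (σ i)
  pos := fun i => w.pos (σ i)
  sum_eq_one := by rw [Equiv.sum_comp σ w.val]; exact w.sum_eq_one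

/-- The two weights `(t, 1 - t)` for `t ∈ (0, 1)`. -/
noncomputable def binary (t : Set.Ioo (0 : ℝ) 1) : PosWeights 2 where
  val := ![(t : ℝ), 1 - (t : ℝ)]
  pos := by
    intro i
    fin_cases i
    · simpa using t.2.1
    · simpa using t.2.2
  sum_eq_one := by simp

/-- The `n + 1` equal weights `1 / (n + 1)`. -/
noncomputable def uniform (n : ℕ) : PosWeights (n + 1) where
  val := fun _ => ((n + 1 : ℕ) : ℝ)⁻¹
  pos := fun _ => by positivity
  sum_eq_one := by
    rw [Finset.sum_const, Finset.card_univ, Fintype.card_fin, nsmul_eq_mul]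
    exact mul_inv_cancel₀ (by positivity)

/-- For `n + 2` weights, the weights `(λ₁, …, λₙ, λₙ₊₁ + λₙ₊₂)`. -/
noncomputable def merge {n : ℕ} (w : PosWeights (n + 2)) : PosWeights (n + 1) where
  val := Fin.snoc (α := fun _ => ℝ) (fun i : Fin n => w.val i.castSucc.castSucc)
    (w.val (Fin.last n).castSucc + w.val (Fin.last (n + 1)))
  pos := by
    intro i
    refine Fin.lastCases ?_ (fun i => ?_) i
    · simpa using add_pos (w.pos _) (w.pos _)
    · simpa using w.pos _
  sum_eq_one := by
    have h := w.sum_eq_one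
    rw [Fin.sum_univ_castSucc, Fin.sum_univ_castSucc] at h
    rw [Fin.sum_univ_castSucc]
    simp only [Fin.snoc_castSucc, Fin.snoc_last]
    linarith

/-- For `n + 2` weights, the two weights `(λₙ₊₁ / (λₙ₊₁ + λₙ₊₂), λₙ₊₂ / (λₙ₊₁ + λₙ₊₂))`. -/
noncomputable def lastTwo {n : ℕ} (w : PosWeights (n + 2)) : PosWeights 2 where
  val := ![w.val (Fin.last n).castSucc /
      (w.val (Fin.last n).castSucc + w.val (Fin.last (n + 1))),
    w.val (Fin.last (n + 1)) /
      (w.val (Fin.last n).castSucc + w.val (Fin.last (n + 1)))]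
  pos := by
    intro i
    have h₁ := w.pos (Fin.last n).castSucc
    have h₂ := w.pos (Fin.last (n + 1))
    fin_cases i
    · exact div_pos h₁ (add_pos h₁ h₂)
    · exact div_pos h₂ (add_pos h₁ h₂)
  sum_eq_one := by
    have h₁ := w.pos (Fin.last n).castSucc
    have h₂ := w.pos (Fin.last (n + 1))
    rw [Fin.sum_univ_two]
    simp only [Matrix.cons_val_zero, Matrix.cons_val_one]
    rw [← add_div]
    exact div_self (add_pos h₁ h₂).ne'

end PosWeights

/-- A convex combination space: a metric space with an operation
`comb w u = [λ₁, u₁; …; λₙ, uₙ]`, defined for strictly positive weights with sum `1`. -/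
class ConvexCombinationSpace (X : Type*) [MetricSpace X] where
  comb : ∀ {n : ℕ}, PosWeights n → (Fin n → X) → X
  /-- `[1, u] = u`. -/
  comb_one : ∀ (w : PosWeights 1) (u : Fin 1 → X), comb w u = u 0
  /-- Commutativity. -/
  comb_perm : ∀ {n : ℕ} (w : PosWeights n) (u : Fin n → X) (σ : Equiv.Perm (Fin n)),
    comb w u = comb (w.perm σ) (fun i => u (σ i))
  /-- Associativity. -/
  comb_assoc : ∀ {n : ℕ} (w : PosWeights (n + 2)) (u : Fin (n + 2) → X),
    comb w u =
      comb w.merge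
        (Fin.snoc (α := fun _ => X) (fun i : Fin n => u i.castSucc.castSucc)
          (comb w.lastTwo ![u (Fin.last n).castSucc, u (Fin.last (n + 1))]))
  /-- Continuity in the weight. -/
  comb_tendsto : ∀ (u v : X) (t : ℕ → Set.Ioo (0 : ℝ) 1) (s : Set.Ioo (0 : ℝ) 1),
    Filter.Tendsto t Filter.atTop (nhds s) →
      Filter.Tendsto (fun k => comb (PosWeights.binary (t k)) ![u, v]) Filter.atTop
        (nhds (comb (PosWeights.binary s) ![u, v]))
  /-- Negative curvature. -/
  dist_comb_le : ∀ (u₁ u₂ v₁ v₂ : X) (t : Set.Ioo (0 : ℝ) 1),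
    dist (comb (PosWeights.binary t) ![u₁, u₂]) (comb (PosWeights.binary t) ![v₁, v₂]) ≤
      (t : ℝ) * dist u₁ v₁ + (1 - (t : ℝ)) * dist u₂ v₂
  /-- Convexification: the sequence `[1/n, u; …; 1/n, u]`, `n ≥ 1`, converges. -/
  exists_tendsto_uniform : ∀ u : X, ∃ l : X,
    Filter.Tendsto (fun n : ℕ => comb (PosWeights.uniform n) (fun _ => u)) Filter.atTop (nhds l)

namespace ConvexCombinationSpace

variable {X : Type*} [MetricSpace X] [ConvexCombinationSpace X]

/-- The convexification operator: `K u` is the limit of `[1/n, u; …; 1/n, u]`. -/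
noncomputable def K (u : X) : X := Classical.choose (exists_tendsto_uniform u)

variable (X) in
/-- `X` is convexifiable if `K(X) = X`. -/
def IsConvexifiable : Prop := Set.range (K : X → X) = Set.univ

open Classical in
/-- The binary combination `[t, x; 1 - t, y]` for `t ∈ [0, 1]`: entries of weight zero are
dropped, so that it is `[1, y] = y` for `t = 0` and `[1, x] = x` for `t = 1`. -/
noncomputable def comb₂ (t : Set.Icc (0 : ℝ) 1) (x y : X) : X :=
  if h : (t : ℝ) ∈ Set.Ioo (0 : ℝ) 1 then comb (PosWeights.binary ⟨t, h⟩) ![x, y]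
  else if (t : ℝ) = 0 then y else x

end ConvexCombinationSpace

open Filter Topology
open scoped NNReal

-- Form the cone of elements `s • x`, adding masses and combining points in proportion to mass; the
-- axioms make it a commutative semigroup. Convexifiability gives `[t, x; 1 - t, x] = x`
-- (`IsConvexifiable.comb_self`), so each ray is additive in the mass.
--
-- Between elements of equal mass, `s * dist x y` is translation invariant (`gap_add_right`).
-- Negative curvature shows that adding `r` does not increase it. Conversely, adding a fixed `r` to
-- `n • p` and `n • q` changes their gap by a bounded amount, while `n` replacements of `p` by `q`
-- bound the result by `n * gap (p + r) (q + r)`; divide by `n`.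
--
-- Hence differences of cone elements of equal mass carry a seminorm (`size_sub`, `size_add_le`,
-- `size_smul`). The space `E` is the completion of the formal combinations of points under it.

attribute [ext] PosWeights

/-- The elements `s • x` with `s > 0` of the open cone over `X`. -/
@[ext]
structure PosCone (X : Type*) where
  mass : ℝ
  mass_pos : 0 < mass
  pt : X

/-! ### Identities for two and three weights. -/

namespace PosWeights

/-- The proportion `s / (s + t)` of `s` in a total of `s + t`. -/
noncomputable def ratio {s t : ℝ} (hs : 0 < s) (ht : 0 < t) : Set.Ioo (0 : ℝ) 1 :=
  ⟨s / (s + t), by positivity, by rw [div_lt_one (by positivity)]; linarith⟩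

theorem one_sub_ratio {s t : ℝ} (hs : 0 < s) (ht : 0 < t) :
    1 - (ratio hs ht : ℝ) = t / (s + t) := by
  have : s + t ≠ 0 := by positivity
  simp only [ratio]
  field_simp
  ring

/-- The three weights proportional to `a`, `b`, `c`. -/
noncomputable def ternary {a b c : ℝ} (ha : 0 < a) (hb : 0 < b) (hc : 0 < c) : PosWeights 3 where
  val := ![a / (a + b + c), b / (a + b + c), c / (a + b + c)]
  pos := by
    intro i
    fin_cases i
    · exact div_pos ha (by positivity)
    · exact div_pos hb (by positivity)
    · exact div_pos hc (by positivity)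
  sum_eq_one := by
    have : a + b + c ≠ 0 := by positivity
    simp only [Fin.sum_univ_three, Matrix.cons_val]
    field_simp

theorem binary_perm_swap {s t : ℝ} (hs : 0 < s) (ht : 0 < t) :
    (binary (ratio hs ht)).perm (Equiv.swap 0 1) = binary (ratio ht hs) := by
  ext i
  have h := one_sub_ratio hs ht
  have h' := one_sub_ratio ht hs
  fin_cases i
  · simpa [perm, binary, ratio, add_comm] using h
  · simpa [perm, binary, ratio, add_comm] using h'.symm

theorem ternary_merge {a b c : ℝ} (ha : 0 < a) (hb : 0 < b) (hc : 0 < c) :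
    (ternary ha hb hc).merge = binary (ratio ha (add_pos hb hc)) := by
  ext i
  fin_cases i
  · simp [merge, ternary, binary, ratio, Fin.snoc, add_assoc]
  · simp [merge, ternary, binary, one_sub_ratio, Fin.snoc, Fin.last, add_assoc, add_div]

theorem ternary_lastTwo {a b c : ℝ} (ha : 0 < a) (hb : 0 < b) (hc : 0 < c) :
    (ternary ha hb hc).lastTwo = binary (ratio hb hc) := by
  have h1 : a + b + c ≠ 0 := by positivity
  have h2 : b + c ≠ 0 := by positivity
  ext i
  fin_cases i
  · simp [lastTwo, ternary, binary, ratio, Fin.last]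
    field_simp
  · simp [lastTwo, ternary, binary, one_sub_ratio, Fin.last]
    field_simp

theorem ternary_perm_finRotate {a b c : ℝ} (ha : 0 < a) (hb : 0 < b) (hc : 0 < c) :
    (ternary ha hb hc).perm (finRotate 3) = ternary hb hc ha := by
  ext i
  have h : a + b + c = b + c + a := by ring
  fin_cases i <;> simp [perm, ternary, h]

theorem lastTwo_eq_binary {n : ℕ} (w : PosWeights (n + 2)) :
    w.lastTwo = binary (ratio (w.pos (Fin.last n).castSucc) (w.pos (Fin.last (n + 1)))) := by
  ext i
  fin_cases i
  · simp [lastTwo, binary, ratio]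
  · simp [lastTwo, binary, one_sub_ratio]

end PosWeights

open PosWeights ConvexCombinationSpace

/-! ### The cone as a commutative semigroup. -/

namespace PosCone

variable {X : Type*} [MetricSpace X] [ConvexCombinationSpace X]

noncomputable instance : Add (PosCone X) where
  add p q := ⟨p.mass + q.mass, add_pos p.mass_pos q.mass_pos,
    comb (binary (ratio p.mass_pos q.mass_pos)) ![p.pt, q.pt]⟩

theorem add_mass (p q : PosCone X) : (p + q).mass = p.mass + q.mass := rfl

theorem add_pt (p q : PosCone X) :
    (p + q).pt = comb (binary (ratio p.mass_pos q.mass_pos)) ![p.pt, q.pt] := rfl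

theorem add_comm' (p q : PosCone X) : p + q = q + p := by
  ext
  · exact add_comm _ _
  · rw [add_pt, add_pt, comb_perm _ _ (Equiv.swap 0 1), binary_perm_swap]
    congr 1
    ext i
    fin_cases i <;> simp

theorem add_add_pt (p q r : PosCone X) :
    (p + (q + r)).pt =
      comb (ternary p.mass_pos q.mass_pos r.mass_pos) ![p.pt, q.pt, r.pt] := by
  rw [comb_assoc, ternary_merge, ternary_lastTwo, add_pt]
  congr 1
  ext i
  fin_cases i <;> simp [Fin.snoc, add_pt, Fin.last]

noncomputable instance : AddCommSemigroup (PosCone X) where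
  add_comm := add_comm'
  add_assoc p q r := by
    -- Both sides become ternary combinations that differ by a cyclic rotation.
    rw [add_comm' (p + q) r]
    ext
    · simp only [add_mass]; ring
    · rw [add_add_pt, add_add_pt, comb_perm _ _ (finRotate 3), ternary_perm_finRotate]
      congr 1
      ext i
      fin_cases i <;> simp

/-- Multiplication of the mass by a positive number. -/
noncomputable def scale {c : ℝ} (hc : 0 < c) : AddHom (PosCone X) (PosCone X) where
  toFun p := ⟨c * p.mass, mul_pos hc p.mass_pos, p.pt⟩
  map_add' p q := by
    ext
    · simp only [add_mass]; ring
    · simp only [add_pt]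
      congr 2
      apply Subtype.ext
      simp only [ratio]
      rw [← mul_add, mul_div_mul_left _ _ hc.ne']

/-- By `comb_assoc`, merging the last two entries is one addition in the cone. The adjoined zero
makes finite sums available. -/
theorem sum_coe_eq {n : ℕ} (w : PosWeights (n + 1)) (u : Fin (n + 1) → X) :
    ∑ i, ((⟨w.val i, w.pos i, u i⟩ : PosCone X) : WithZero (PosCone X)) =
      ((⟨1, one_pos, comb w u⟩ : PosCone X) : WithZero (PosCone X)) := by
  induction n with
  | zero =>
    have h := w.sum_eq_one
    simp only [Nat.reduceAdd, Finset.univ_unique, Fin.default_eq_zero, Fin.isValue,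
      Finset.sum_singleton] at h ⊢
    congr 1
    ext
    · exact h
    · exact (comb_one w u).symm
  | succ n ih =>
    rw [comb_assoc, ← ih, Fin.sum_univ_castSucc, Fin.sum_univ_castSucc, Fin.sum_univ_castSucc,
      add_assoc, ← WithZero.coe_add]
    congr 1
    · refine Finset.sum_congr rfl fun i _ => ?_
      congr 1
      ext <;> simp [merge]
    · congr 1
      ext
      · simp [merge, add_mass]
      · simp [add_pt, lastTwo_eq_binary]

theorem scale_mk {c s : ℝ} (hc : 0 < c) (hs : 0 < s) (x : X) :
    scale hc ⟨s, hs, x⟩ = ⟨c * s, mul_pos hc hs, x⟩ := rfl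

theorem succ_nsmul_coe (n : ℕ) {s : ℝ} (hs : 0 < s) (x : X) :
    (n + 1) • ((⟨s, hs, x⟩ : PosCone X) : WithZero (PosCone X)) =
      ((⟨(n + 1 : ℕ) * s, by positivity, comb (uniform n) fun _ => x⟩ : PosCone X) :
        WithZero (PosCone X)) := by
  have hc : 0 < (n + 1 : ℕ) * s := by positivity
  have hn : ((n + 1 : ℕ) : ℝ) ≠ 0 := by positivity
  have h := congrArg (WithZero.mapAddHom (scale (X := X) hc))
    (sum_coe_eq (uniform n) fun _ => x)
  simp only [map_sum, WithZero.mapAddHom_coe, scale_mk, mul_one] at h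
  have e (i : Fin (n + 1)) : (n + 1 : ℕ) * s * (uniform n).val i = s := by
    simp only [uniform]
    field_simp
  simp only [e] at h
  rw [← h]
  exact ((Fin.sum_const (n + 1) ((⟨s, hs, x⟩ : PosCone X) : WithZero (PosCone X)))).symm

/-- Split `m + n + 2` copies of `x` in the cone into `m + 1` and `n + 1`; `uniform k` has `k + 1`
weights. -/
theorem comb_uniform_add (m n : ℕ) (x : X) :
    comb (uniform (m + n + 1)) (fun _ => x) =
      comb (binary (ratio (s := (m + 1 : ℕ)) (t := (n + 1 : ℕ)) (by positivity) (by positivity)))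
        ![comb (uniform m) fun _ => x, comb (uniform n) fun _ => x] := by
  have h := succ_nsmul_coe (m + n + 1) one_pos x
  have e : (m + n + 1 + 1) • ((⟨1, one_pos, x⟩ : PosCone X) : WithZero (PosCone X)) =
      (m + 1) • ((⟨1, one_pos, x⟩ : PosCone X) : WithZero (PosCone X)) +
        (n + 1) • ((⟨1, one_pos, x⟩ : PosCone X) : WithZero (PosCone X)) := by
    rw [← add_nsmul]
    congr 1
    ring
  rw [e, succ_nsmul_coe, succ_nsmul_coe, ← WithZero.coe_add, WithZero.coe_inj] at h
  have h' := congrArg pt h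
  rw [add_pt] at h'
  simp only [mul_one] at h'
  exact h'.symm

end PosCone

/-! ### Idempotence of binary combinations. -/

namespace ConvexCombinationSpace

variable {X : Type*} [MetricSpace X] [ConvexCombinationSpace X]

theorem tendsto_uniform_K (u : X) :
    Tendsto (fun n : ℕ => comb (uniform n) fun _ => u) atTop (𝓝 (K u)) :=
  Classical.choose_spec (exists_tendsto_uniform u)

theorem tendsto_comb_binary (t : Set.Ioo (0 : ℝ) 1) {f g : ℕ → X} {x y : X}
    (hf : Tendsto f atTop (𝓝 x)) (hg : Tendsto g atTop (𝓝 y)) :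
    Tendsto (fun n => comb (binary t) ![f n, g n]) atTop (𝓝 (comb (binary t) ![x, y])) := by
  rw [tendsto_iff_dist_tendsto_zero] at hf hg ⊢
  refine squeeze_zero (fun _ => dist_nonneg) (fun n => dist_comb_le _ _ _ _ t) ?_
  simpa using (hf.const_mul (t : ℝ)).add (hg.const_mul (1 - (t : ℝ)))

/-- Apply `comb_uniform_add` to `(N + 1) * (p + 1)` and `(N + 1) * (q + 1)` copies of `u`: the ratio
does not depend on `N`, and all three uniform combinations tend to `K u`. -/
theorem comb_ratio_K (p q : ℕ) (u : X) :
    comb (binary (ratio (s := (p + 1 : ℕ)) (t := (q + 1 : ℕ)) (by positivity) (by positivity)))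
      ![K u, K u] = K u := by
  have hmul (r : ℕ) : Tendsto (fun N : ℕ => (N + 1) * (r + 1) - 1) atTop atTop := by
    refine tendsto_atTop_mono (fun N => ?_) tendsto_id
    have : N + 1 ≤ (N + 1) * (r + 1) := Nat.le_mul_of_pos_right _ (by omega)
    simp only [id]
    omega
  have h₁ := tendsto_comb_binary
    (ratio (s := (p + 1 : ℕ)) (t := (q + 1 : ℕ)) (by positivity) (by positivity))
    ((tendsto_uniform_K u).comp (hmul p)) ((tendsto_uniform_K u).comp (hmul q))
  refine tendsto_nhds_unique h₁ (((tendsto_uniform_K u).comp (hmul (p + q + 1))).congr fun N => ?_)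
  have e : (N + 1) * (p + q + 1 + 1) - 1 =
      ((N + 1) * (p + 1) - 1) + ((N + 1) * (q + 1) - 1) + 1 := by
    have h1 : 0 < (N + 1) * (p + 1) := by positivity
    have h2 : 0 < (N + 1) * (q + 1) := by positivity
    have h3 : (N + 1) * (p + q + 1 + 1) = (N + 1) * (p + 1) + (N + 1) * (q + 1) := by ring
    omega
  simp only [Function.comp]
  rw [e, PosCone.comb_uniform_add]
  congr 2
  apply Subtype.ext
  simp only [ratio]
  rw [Nat.sub_add_cancel (by positivity : 0 < (N + 1) * (p + 1)),
    Nat.sub_add_cancel (by positivity : 0 < (N + 1) * (q + 1))]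
  push_cast
  rw [← mul_add, mul_div_mul_left _ _ (by positivity)]

/-- In a convexifiable space, `[t, x; 1 - t, x] = x`. -/
theorem IsConvexifiable.comb_self (hX : IsConvexifiable X) (t : Set.Ioo (0 : ℝ) 1) (x : X) :
    comb (binary t) ![x, x] = x := by
  obtain ⟨u, rfl⟩ : x ∈ Set.range (K : X → X) := hX ▸ Set.mem_univ x
  -- Rational weights come from `comb_ratio_K`; real ones follow by approximating `t` from above and
  -- continuity in the weight.
  have hrat (a : ℚ) (ha : (a : ℝ) ∈ Set.Ioo (0 : ℝ) 1) :
      comb (binary ⟨a, ha⟩) ![K u, K u] = K u := by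
    have h0 : 0 < a := by exact_mod_cast ha.1
    have h1 : a < 1 := by exact_mod_cast ha.2
    have hn : 0 < a.num := Rat.num_pos.2 h0
    have hd : a.num < a.den := Rat.num_lt_denom_iff.2 h1
    obtain ⟨p, hp⟩ : ∃ p : ℕ, a.num = (p + 1 : ℕ) := ⟨a.num.toNat - 1, by omega⟩
    obtain ⟨q, hq⟩ : ∃ q : ℕ, a.den = (p + 1) + (q + 1) := ⟨a.den - p - 2, by omega⟩
    refine Eq.trans ?_ (comb_ratio_K p q u)
    congr 2
    apply Subtype.ext
    simp only [ratio]
    rw [Rat.cast_def, hp, hq]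
    push_cast
    rfl
  have hex (k : ℕ) : ∃ a : ℚ, (t : ℝ) < a ∧ (a : ℝ) < min 1 (t + 1 / ((k : ℝ) + 1)) :=
    exists_rat_btwn (lt_min t.2.2 (by linarith [Nat.one_div_pos_of_nat (α := ℝ) (n := k)]))
  choose a ha ha' using hex
  have hmem (k : ℕ) : (a k : ℝ) ∈ Set.Ioo (0 : ℝ) 1 :=
    ⟨t.2.1.trans (ha k), (ha' k).trans_le (min_le_left _ _)⟩
  have hlim : Tendsto (fun k => (⟨a k, hmem k⟩ : Set.Ioo (0 : ℝ) 1)) atTop (𝓝 t) := by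
    rw [tendsto_subtype_rng]
    refine tendsto_of_tendsto_of_tendsto_of_le_of_le tendsto_const_nhds ?_
      (fun k => (ha k).le) (fun k => ((ha' k).trans_le (min_le_right _ _)).le)
    simpa using tendsto_one_div_add_atTop_nhds_zero_nat.const_add (t : ℝ)
  refine tendsto_nhds_unique (comb_tendsto (K u) (K u) _ t hlim) ?_
  simp only [hrat]
  exact tendsto_const_nhds

end ConvexCombinationSpace

/-! ### The gap and its translation invariance. -/

namespace PosCone

variable {X : Type*} [MetricSpace X]

/-- The distance `s * dist x y` of `s • x` and `s • y`, meaningful for elements of equal mass. -/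
noncomputable def gap (p q : WithZero (PosCone X)) : ℝ :=
  -- If just one argument is zero, the value `0` is a convention; equal masses exclude this case.
  WithZero.recZeroCoe 0
    (fun a => WithZero.recZeroCoe 0 (fun b : PosCone X => a.mass * dist a.pt b.pt) q) p

theorem gap_zero_left (q : WithZero (PosCone X)) : gap 0 q = 0 := rfl

theorem gap_coe (a b : PosCone X) :
    gap (a : WithZero (PosCone X)) b = a.mass * dist a.pt b.pt := rfl

theorem gap_self (p : WithZero (PosCone X)) : gap p p = 0 := by
  induction p with
  | zero => rfl
  | coe a => simp [gap_coe]

variable [ConvexCombinationSpace X]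

/-- The mass as an additive map on the cone with zero. -/
noncomputable def massHom : WithZero (PosCone X) →+ ℝ :=
  WithZero.lift ⟨mass, add_mass⟩

theorem massHom_coe (p : PosCone X) : massHom (p : WithZero (PosCone X)) = p.mass := rfl

theorem eq_zero_of_massHom {q : WithZero (PosCone X)} (h : massHom q = 0) : q = 0 := by
  induction q with
  | zero => rfl
  | coe a => exact absurd h a.mass_pos.ne'

theorem exists_coe_of_massHom_eq {p : PosCone X} {q : WithZero (PosCone X)}
    (h : massHom (p : WithZero (PosCone X)) = massHom q) :
    ∃ b : PosCone X, q = b ∧ p.mass = b.mass := by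
  induction q with
  | zero => exact absurd h p.mass_pos.ne'
  | coe b => exact ⟨b, rfl, h⟩

theorem gap_comm {p q : WithZero (PosCone X)} (h : massHom p = massHom q) :
    gap p q = gap q p := by
  induction p with
  | zero => rw [eq_zero_of_massHom (q := q) (by simpa using h.symm)]
  | coe a =>
    obtain ⟨b, rfl, hb⟩ := exists_coe_of_massHom_eq h
    rw [gap_coe, gap_coe, hb, dist_comm]

theorem gap_triangle {p q r : WithZero (PosCone X)} (hpq : massHom p = massHom q)
    (hqr : massHom q = massHom r) : gap p r ≤ gap p q + gap q r := by
  induction p with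
  | zero =>
    rw [eq_zero_of_massHom (q := q) (by simpa using hpq.symm)]
    simp [gap_zero_left]
  | coe a =>
    obtain ⟨b, rfl, hb⟩ := exists_coe_of_massHom_eq hpq
    obtain ⟨c, rfl, hc⟩ := exists_coe_of_massHom_eq hqr
    rw [gap_coe, gap_coe, gap_coe, ← hb, ← mul_add]
    exact mul_le_mul_of_nonneg_left (dist_triangle _ _ _) a.mass_pos.le

theorem gap_mapAddHom_scale {c : ℝ} (hc : 0 < c) (p q : WithZero (PosCone X)) :
    gap (WithZero.mapAddHom (scale hc) p) (WithZero.mapAddHom (scale hc) q) = c * gap p q := by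
  induction p with
  | zero => simp [gap_zero_left]
  | coe a =>
    induction q with
    | zero => simp [gap]
    | coe b =>
      simp only [WithZero.mapAddHom_coe, gap_coe]
      exact mul_assoc _ _ _

theorem gap_add_right_le {p q : WithZero (PosCone X)} (h : massHom p = massHom q)
    (r : WithZero (PosCone X)) : gap (p + r) (q + r) ≤ gap p q := by
  induction p with
  | zero =>
    rw [eq_zero_of_massHom (q := q) (by simpa using h.symm), gap_self, gap_self]
  | coe a =>
    obtain ⟨b, rfl, hb⟩ := exists_coe_of_massHom_eq h
    induction r with
    | zero => simp
    | coe c =>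
      obtain ⟨s, hs, x⟩ := a
      obtain ⟨s', hs', y⟩ := b
      obtain ⟨t, ht, z⟩ := c
      obtain rfl : s = s' := hb
      rw [← WithZero.coe_add, ← WithZero.coe_add, gap_coe, gap_coe]
      simp only [add_mass, add_pt]
      have hd := dist_comb_le x z y z (ratio hs ht)
      have h0 : s + t ≠ 0 := by positivity
      calc (s + t) * _ ≤ (s + t) * _ := mul_le_mul_of_nonneg_left hd (by positivity)
        _ = s * dist x y := by
          simp only [ratio, dist_self, mul_zero, add_zero]
          field_simp

/-- Replace the copies of `p` by `q` one at a time, keeping a single `r`: each replacement costs at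
most `gap (p + r) (q + r)`. -/
theorem gap_nsmul_add_le {p q : WithZero (PosCone X)} (h : massHom p = massHom q)
    (r : WithZero (PosCone X)) (n : ℕ) :
    gap (n • p + r) (n • q + r) ≤ n * gap (p + r) (q + r) := by
  induction n with
  | zero => simp [gap_self]
  | succ n ih =>
    have e₁ : (n + 1) • p + r = (n • p + r) + p := by rw [succ_nsmul]; abel
    have e₂ : (n + 1) • q + r = (q + r) + n • q := by rw [succ_nsmul]; abel
    have e₃ : (n • q + r) + p = (p + r) + n • q := by abel
    have h₁ := gap_triangle (p := (n • p + r) + p) (q := (n • q + r) + p) (r := (q + r) + n • q)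
      (by simp [h]) (by simp [h]; ring)
    have h₂ := gap_add_right_le (p := n • p + r) (q := n • q + r) (by simp [h]) p
    have h₃ := gap_add_right_le (p := p + r) (q := q + r) (by simp [h]) (n • q)
    rw [e₁, e₂]
    rw [e₃] at h₁ h₂
    push_cast
    linarith


theorem mk_add_mk (hX : IsConvexifiable X) {s t : ℝ} (hs : 0 < s) (ht : 0 < t) (x : X) :
    (⟨s, hs, x⟩ : PosCone X) + ⟨t, ht, x⟩ = ⟨s + t, add_pos hs ht, x⟩ := by
  ext
  · rfl
  · exact hX.comb_self _ x

theorem succ_nsmul_coe_mk (hX : IsConvexifiable X) (n : ℕ) {s : ℝ} (hs : 0 < s) (x : X) :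
    (n + 1) • ((⟨s, hs, x⟩ : PosCone X) : WithZero (PosCone X)) =
      ((⟨(n + 1 : ℕ) * s, by positivity, x⟩ : PosCone X) : WithZero (PosCone X)) := by
  induction n with
  | zero => simp
  | succ n ih =>
    rw [succ_nsmul, ih, ← WithZero.coe_add, mk_add_mk hX]
    congr 2
    push_cast
    ring

/-- Adding mass `t` at `z` to mass `s` at `x` moves the point by at most `t / (s + t) * dist x z`.
Times `s + t`, this error is independent of `s`. -/
theorem mass_mul_dist_le (hX : IsConvexifiable X) (a b c : PosCone X) (h : a.mass = b.mass) :
    a.mass * dist a.pt b.pt ≤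
      (a + c).mass * dist (a + c).pt (b + c).pt +
        c.mass * (dist a.pt c.pt + dist b.pt c.pt) := by
  obtain ⟨s, hs, x⟩ := a
  obtain ⟨s', hs', y⟩ := b
  obtain ⟨t, ht, z⟩ := c
  obtain rfl : s = s' := h
  simp only [add_mass, add_pt]
  have hx := dist_comb_le x x x z (ratio hs ht)
  have hy := dist_comb_le y y y z (ratio hs ht)
  rw [hX.comb_self, one_sub_ratio, dist_self, mul_zero, zero_add] at hx hy
  set m := comb (binary (ratio hs ht)) ![x, z]
  set m' := comb (binary (ratio hs ht)) ![y, z]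
  have h4 := dist_triangle4 x m m' y
  rw [dist_comm m' y] at h4
  have hst : 0 < s + t := by positivity
  have key : (s + t) * dist x y ≤
      (s + t) * (t / (s + t) * dist x z + dist m m' + t / (s + t) * dist y z) :=
    mul_le_mul_of_nonneg_left (by linarith) hst.le
  have e : (s + t) * (t / (s + t) * dist x z + dist m m' + t / (s + t) * dist y z) =
      (s + t) * dist m m' + t * (dist x z + dist y z) := by
    field_simp
    ring
  nlinarith [mul_nonneg ht.le (dist_nonneg (x := x) (y := y))]

theorem gap_le_add_right (hX : IsConvexifiable X) {p q : WithZero (PosCone X)}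
    (h : massHom p = massHom q) (r : WithZero (PosCone X)) :
    gap p q ≤ gap (p + r) (q + r) := by
  induction p with
  | zero =>
    rw [eq_zero_of_massHom (q := q) (by simpa using h.symm), gap_self, gap_self]
  | coe a =>
    obtain ⟨b, rfl, hb⟩ := exists_coe_of_massHom_eq h
    induction r with
    | zero => simp
    | coe c =>
      obtain ⟨s, hs, x⟩ := a
      obtain ⟨s', hs', y⟩ := b
      obtain rfl : s = s' := hb
      set G := gap (((⟨s, hs, x⟩ : PosCone X) : WithZero (PosCone X)) + (c : WithZero (PosCone X)))
        (((⟨s, hs', y⟩ : PosCone X) : WithZero (PosCone X)) + (c : WithZero (PosCone X)))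
      set R := c.mass * (dist x c.pt + dist y c.pt)
      -- `R` does not depend on `n`, so large `n` forces `s * dist x y ≤ G`.
      have hn (n : ℕ) : (n + 1 : ℕ) * (s * dist x y) ≤ (n + 1 : ℕ) * G + R := by
        have h₁ := gap_nsmul_add_le h c (n + 1)
        rw [succ_nsmul_coe_mk hX, succ_nsmul_coe_mk hX, ← WithZero.coe_add, ← WithZero.coe_add,
          gap_coe] at h₁
        have h₂ := mass_mul_dist_le hX ⟨(n + 1 : ℕ) * s, by positivity, x⟩
          ⟨(n + 1 : ℕ) * s, by positivity, y⟩ c rfl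
        simp only at h₂
        rw [← mul_assoc]
        linarith
      rw [gap_coe]
      by_contra! hlt
      simp only at hlt
      obtain ⟨n, hn'⟩ := exists_nat_gt (R / (s * dist x y - G))
      rw [div_lt_iff₀ (by linarith)] at hn'
      have := hn n
      push_cast at this
      nlinarith

/-- Translation invariance of `gap`. -/
theorem gap_add_right (hX : IsConvexifiable X) {p q : WithZero (PosCone X)}
    (h : massHom p = massHom q) (r : WithZero (PosCone X)) :
    gap (p + r) (q + r) = gap p q :=
  (gap_add_right_le h r).antisymm (gap_le_add_right hX h r)

/-! ### Formal nonnegative combinations and their sums in the cone. -/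

/-- The ray `s ↦ s • x` of the cone. -/
noncomputable def ray (hX : IsConvexifiable X) (x : X) : ℝ≥0 →+ WithZero (PosCone X) where
  toFun s := if h : 0 < s then ((⟨s, NNReal.coe_pos.2 h, x⟩ : PosCone X) : WithZero (PosCone X)) else 0
  map_zero' := by simp
  map_add' s t := by
    rcases eq_zero_or_pos s with rfl | hs
    · simp
    rcases eq_zero_or_pos t with rfl | ht
    · simp
    rw [dif_pos hs, dif_pos ht, dif_pos (add_pos hs ht), ← WithZero.coe_add, mk_add_mk hX]
    rfl

theorem ray_of_pos (hX : IsConvexifiable X) (x : X) {s : ℝ≥0} (hs : 0 < s) :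
    ray hX x s = ((⟨s, NNReal.coe_pos.2 hs, x⟩ : PosCone X) : WithZero (PosCone X)) := dif_pos hs

/-- The sum in the cone of a finitely supported family of masses. -/
noncomputable def total (hX : IsConvexifiable X) : (X →₀ ℝ≥0) →+ WithZero (PosCone X) :=
  Finsupp.liftAddHom (ray hX)

theorem total_single (hX : IsConvexifiable X) (x : X) (s : ℝ≥0) :
    total hX (Finsupp.single x s) = ray hX x s := by
  simp [total]

theorem total_smul (hX : IsConvexifiable X) {c : ℝ≥0} (hc : 0 < c) (a : X →₀ ℝ≥0) :
    total hX (c • a) =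
      WithZero.mapAddHom (scale (c := (c : ℝ)) (by exact_mod_cast hc)) (total hX a) := by
  induction a using Finsupp.induction_linear with
  | zero => simp
  | add a b ha hb => rw [smul_add, map_add, ha, hb, map_add, map_add]
  | single x s =>
    rw [Finsupp.smul_single, total_single, total_single]
    rcases eq_zero_or_pos s with rfl | hs
    · simp
    rw [ray_of_pos hX x hs, smul_eq_mul, ray_of_pos hX x (mul_pos hc hs)]
    rfl

/-! ### The seminorm on formal real combinations. -/

/-- The sum of the coefficients. -/
noncomputable def weight (X : Type*) : (X →₀ ℝ) →ₗ[ℝ] ℝ :=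
  Finsupp.linearCombination ℝ fun _ => (1 : ℝ)

theorem weight_single {X : Type*} (x : X) (s : ℝ) : weight X (Finsupp.single x s) = s := by
  simp [weight]

/-- Nonnegative coefficients as real coefficients. -/
noncomputable def toRealCoeff (X : Type*) : (X →₀ ℝ≥0) →+ (X →₀ ℝ) :=
  Finsupp.mapRange.addMonoidHom NNReal.toRealHom.toAddMonoidHom

theorem toRealCoeff_apply {X : Type*} (a : X →₀ ℝ≥0) (x : X) : toRealCoeff X a x = a x := rfl

theorem toRealCoeff_single {X : Type*} (x : X) (s : ℝ≥0) :
    toRealCoeff X (Finsupp.single x s) = Finsupp.single x (s : ℝ) := by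
  simp [toRealCoeff]

theorem massHom_total (hX : IsConvexifiable X) (a : X →₀ ℝ≥0) :
    massHom (total hX a) = weight X (toRealCoeff X a) := by
  induction a using Finsupp.induction_linear with
  | zero => simp
  | add a b ha hb => simp only [map_add, ha, hb]
  | single x s =>
    rw [total_single, toRealCoeff_single, weight_single]
    rcases eq_zero_or_pos s with rfl | hs
    · simp
    rw [ray_of_pos hX x hs, massHom_coe]

/-- The positive parts of the coefficients. -/
noncomputable def posCoeff {X : Type*} (v : X →₀ ℝ) : X →₀ ℝ≥0 :=
  v.mapRange Real.toNNReal Real.toNNReal_zero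

theorem toRealCoeff_posCoeff_sub {X : Type*} (v : X →₀ ℝ) :
    toRealCoeff X (posCoeff v) - toRealCoeff X (posCoeff (-v)) = v := by
  ext x
  simp only [Finsupp.sub_apply, toRealCoeff_apply, posCoeff, Finsupp.mapRange_apply,
    Finsupp.neg_apply, Real.coe_toNNReal']
  rcases le_total 0 (v x) with h | h
  · rw [max_eq_left h, max_eq_right (by linarith)]; ring
  · rw [max_eq_right h, max_eq_left (by linarith)]; ring

/-- The size of a formal combination of weight zero. -/
noncomputable def size (hX : IsConvexifiable X) (v : X →₀ ℝ) : ℝ :=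
  gap (total hX (posCoeff v)) (total hX (posCoeff (-v)))

theorem massHom_total_eq (hX : IsConvexifiable X) {a b : X →₀ ℝ≥0}
    (h : weight X (toRealCoeff X a - toRealCoeff X b) = 0) :
    massHom (total hX a) = massHom (total hX b) := by
  rw [massHom_total, massHom_total]
  rwa [map_sub, sub_eq_zero] at h

/-- Any two representations of `v` as a difference agree after adding a common term to both parts,
which leaves the gap unchanged. So `size` may be computed from any of them. -/
theorem size_sub (hX : IsConvexifiable X) {a b : X →₀ ℝ≥0}
    (h : weight X (toRealCoeff X a - toRealCoeff X b) = 0) :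
    size hX (toRealCoeff X a - toRealCoeff X b) = gap (total hX a) (total hX b) := by
  set v := toRealCoeff X a - toRealCoeff X b with hv
  have e := toRealCoeff_posCoeff_sub v
  have hab : posCoeff v + b = a + posCoeff (-v) := by
    ext x
    have h₁ := DFunLike.congr_fun e x
    have h₂ := DFunLike.congr_fun hv x
    simp only [Finsupp.sub_apply, toRealCoeff_apply] at h₁ h₂
    simp only [Finsupp.add_apply, NNReal.coe_add]
    linarith
  have hm := massHom_total_eq hX h
  have hm' := massHom_total_eq hX (a := posCoeff v) (b := posCoeff (-v)) (by rw [e, h])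
  rw [size, ← gap_add_right hX hm' (total hX b), ← map_add, hab, map_add,
    add_comm (total hX (posCoeff (-v))), gap_add_right hX hm]

theorem size_neg (hX : IsConvexifiable X) {v : X →₀ ℝ} (h : weight X v = 0) :
    size hX (-v) = size hX v := by
  rw [size, size, neg_neg]
  exact (gap_comm (massHom_total_eq hX (by rw [toRealCoeff_posCoeff_sub, h]))).symm

theorem size_add_le (hX : IsConvexifiable X) {v w : X →₀ ℝ} (hv : weight X v = 0)
    (hw : weight X w = 0) : size hX (v + w) ≤ size hX v + size hX w := by
  obtain ⟨a, b, rfl⟩ : ∃ a b, toRealCoeff X a - toRealCoeff X b = v :=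
    ⟨_, _, toRealCoeff_posCoeff_sub v⟩
  obtain ⟨c, d, rfl⟩ : ∃ a b, toRealCoeff X a - toRealCoeff X b = w :=
    ⟨_, _, toRealCoeff_posCoeff_sub w⟩
  have h := add_eq_zero_iff_eq_neg.2 (hv.trans (by rw [hw, neg_zero] : (0 : ℝ) = -weight X _))
  rw [← map_add] at h
  rw [sub_add_sub_comm, ← map_add, ← map_add] at h ⊢
  rw [size_sub hX hv, size_sub hX hw, size_sub hX h, map_add, map_add]
  have hm := massHom_total_eq hX hv
  have hm' := massHom_total_eq hX hw
  -- The intermediate point shares `c` with one end and `b` with the other, so both gaps reduce by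
  -- translation.
  refine (gap_triangle (q := total hX b + total hX c) (by simp [hm]) (by simp [hm'])).trans ?_
  rw [gap_add_right hX hm, add_comm (total hX b), add_comm (total hX b), gap_add_right hX hm']

theorem size_zero (hX : IsConvexifiable X) : size hX 0 = 0 := by
  rw [size, neg_zero, gap_self]

theorem size_smul_of_pos (hX : IsConvexifiable X) {v : X →₀ ℝ} (hv : weight X v = 0) {c : ℝ}
    (hc : 0 < c) : size hX (c • v) = c * size hX v := by
  obtain ⟨a, b, rfl⟩ : ∃ a b, toRealCoeff X a - toRealCoeff X b = v :=
    ⟨_, _, toRealCoeff_posCoeff_sub v⟩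
  lift c to ℝ≥0 using hc.le
  have e : (c : ℝ) • (toRealCoeff X a - toRealCoeff X b) =
      toRealCoeff X (c • a) - toRealCoeff X (c • b) := by
    ext x
    simp only [Finsupp.smul_apply, Finsupp.sub_apply, toRealCoeff_apply, smul_eq_mul,
      NNReal.coe_mul]
    ring
  have h : weight X ((c : ℝ) • (toRealCoeff X a - toRealCoeff X b)) = 0 := by simp [hv]
  rw [e] at h ⊢
  have hc' : 0 < c := by exact_mod_cast hc
  rw [size_sub hX h, size_sub hX hv, total_smul hX hc', total_smul hX hc', gap_mapAddHom_scale]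

theorem size_smul (hX : IsConvexifiable X) {v : X →₀ ℝ} (hv : weight X v = 0) (c : ℝ) :
    size hX (c • v) = ‖c‖ * size hX v := by
  rcases lt_trichotomy c 0 with hc | rfl | hc
  · rw [← size_neg hX (by simp [hv]), ← neg_smul, size_smul_of_pos hX hv (by linarith),
      Real.norm_of_nonpos hc.le]
  · simp [size_zero]
  · rw [size_smul_of_pos hX hv hc, Real.norm_of_nonneg hc.le]

/-- The combination of weight zero obtained by compensating at `x₀`. -/
noncomputable def recenter {X : Type*} (x₀ : X) : (X →₀ ℝ) →ₗ[ℝ] (X →₀ ℝ) :=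
  LinearMap.id - (weight X).smulRight (Finsupp.single x₀ 1)

theorem weight_recenter {X : Type*} (x₀ : X) (v : X →₀ ℝ) : weight X (recenter x₀ v) = 0 := by
  simp [recenter, weight_single]

theorem recenter_of_weight_eq_zero {X : Type*} (x₀ : X) {v : X →₀ ℝ} (h : weight X v = 0) :
    recenter x₀ v = v := by
  simp [recenter, h]

/-- The seminorm on formal combinations of points that vanishes at `x₀`. -/
noncomputable def sizeSeminorm (hX : IsConvexifiable X) (x₀ : X) : Seminorm ℝ (X →₀ ℝ) :=
  -- The laws for `size` need weight zero; recentering extends it to all combinations.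
  Seminorm.of (fun v => size hX (recenter x₀ v))
    (fun v w => by
      rw [map_add]
      exact size_add_le hX (weight_recenter x₀ v) (weight_recenter x₀ w))
    (fun c v => by rw [map_smul, size_smul hX (weight_recenter x₀ v)])

theorem sizeSeminorm_apply (hX : IsConvexifiable X) (x₀ : X) (v : X →₀ ℝ) :
    sizeSeminorm hX x₀ v = size hX (recenter x₀ v) := rfl

theorem sizeSeminorm_sub (hX : IsConvexifiable X) (x₀ : X) {a b : X →₀ ℝ≥0}
    (h : weight X (toRealCoeff X a - toRealCoeff X b) = 0) :
    sizeSeminorm hX x₀ (toRealCoeff X a - toRealCoeff X b) = gap (total hX a) (total hX b) := by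
  rw [← size_sub hX h, sizeSeminorm_apply, recenter_of_weight_eq_zero x₀ h]

theorem sizeSeminorm_single_sub (hX : IsConvexifiable X) (x₀ x y : X) :
    sizeSeminorm hX x₀ (Finsupp.single x 1 - Finsupp.single y 1) = dist x y := by
  have h := sizeSeminorm_sub hX x₀ (a := Finsupp.single x 1) (b := Finsupp.single y 1)
  simp only [toRealCoeff_single, NNReal.coe_one, total_single, ray_of_pos hX _ one_pos,
    gap_coe, one_mul] at h
  exact h (by simp [weight_single])

/-- In the cone, `t • x + (1 - t) • y` is by construction the mass `1` at `[t, x; 1 - t, y]`, so the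
two sides have gap zero. -/
theorem sizeSeminorm_comb (hX : IsConvexifiable X) (x₀ x y : X) (t : Set.Ioo (0 : ℝ) 1) :
    sizeSeminorm hX x₀ (Finsupp.single (comb (binary t) ![x, y]) 1 -
      ((t : ℝ) • Finsupp.single x 1 + (1 - (t : ℝ)) • Finsupp.single y 1)) = 0 := by
  obtain ⟨t, ht⟩ := t
  obtain ⟨h0, h1⟩ := id ht
  have h1' : 0 < 1 - t := by linarith
  lift t to ℝ≥0 using h0.le
  obtain ⟨s, hs⟩ : ∃ s : ℝ≥0, (s : ℝ) = 1 - t := ⟨⟨1 - t, h1'.le⟩, rfl⟩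
  have hs' : 0 < s := by rw [← NNReal.coe_pos, hs]; exact h1'
  have ht' : 0 < t := by exact_mod_cast h0
  have h := sizeSeminorm_sub hX x₀ (a := Finsupp.single (comb (binary ⟨t, ht⟩) ![x, y]) 1)
    (b := Finsupp.single x t + Finsupp.single y s)
  simp only [map_add, toRealCoeff_single, NNReal.coe_one, total_single, ray_of_pos hX _ one_pos,
    ray_of_pos hX _ hs', ray_of_pos hX _ ht', ← WithZero.coe_add, gap_coe, one_mul, add_pt] at h
  simp only [Finsupp.smul_single, smul_eq_mul, mul_one]
  rw [← hs, h (by simp [weight_single, hs])]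
  rw [dist_eq_zero]
  congr 2
  apply Subtype.ext
  simp [ratio, hs]

end PosCone

/-! ### The embedding into the completion. -/

open PosCone

theorem theorem3p3 {X : Type u} [MetricSpace X] [CompleteSpace X] [ConvexCombinationSpace X]
    (hX : ConvexCombinationSpace.IsConvexifiable X) :
    ∃ (E : Type u) (_ : NormedAddCommGroup E) (_ : NormedSpace ℝ E) (_ : CompleteSpace E)
      (j : X → E),
      Function.Injective j ∧
      IsClosed (Set.range j) ∧
      Convex ℝ (Set.range j) ∧
      (∀ (x y : X) (t : Set.Icc (0 : ℝ) 1),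
        j (ConvexCombinationSpace.comb₂ t x y) = (t : ℝ) • j x + (1 - (t : ℝ)) • j y) ∧
      (∀ x y : X, dist x y = ‖j x - j y‖) ∧
      (TopologicalSpace.SeparableSpace X → TopologicalSpace.SeparableSpace E) := by
  -- An empty `X` offers no base point and embeds in the zero space.
  rcases isEmpty_or_nonempty X with hE | ⟨⟨x₀⟩⟩
  · refine ⟨PUnit, inferInstance, inferInstance, inferInstance, isEmptyElim,
      fun x => isEmptyElim x, ?_, ?_, fun x => isEmptyElim x, fun x => isEmptyElim x,
      fun _ => inferInstance⟩
    · rw [Set.range_eq_empty]; exact isClosed_empty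
    · rw [Set.range_eq_empty]; exact convex_empty
  let _ : SeminormedAddCommGroup (X →₀ ℝ) :=
    (sizeSeminorm hX x₀).toAddGroupSeminorm.toSeminormedAddCommGroup
  have hnorm (v : X →₀ ℝ) : ‖v‖ = sizeSeminorm hX x₀ v := rfl
  let _ : NormedSpace ℝ (X →₀ ℝ) :=
    { norm_smul_le := fun c v => by rw [hnorm, hnorm, map_smul_eq_mul] }
  -- The completion is Hausdorff, so it also kills the null vectors of the seminorm; this makes `j`
  -- affine.
  let j : X → UniformSpace.Completion (X →₀ ℝ) := fun x => (Finsupp.single x (1 : ℝ) : X →₀ ℝ)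
  have hdist (x y : X) : dist x y = ‖j x - j y‖ := by
    simp only [j]
    rw [← UniformSpace.Completion.coe_sub, UniformSpace.Completion.norm_coe, hnorm,
      sizeSeminorm_single_sub]
  have hiso : Isometry j := Isometry.of_dist_eq fun x y => by rw [hdist, dist_eq_norm]
  have hcomb (x y : X) (t : Set.Icc (0 : ℝ) 1) :
      j (comb₂ t x y) = (t : ℝ) • j x + (1 - (t : ℝ)) • j y := by
    rw [comb₂]
    split_ifs with h h0
    · rw [← sub_eq_zero, ← norm_eq_zero]
      simp only [j]
      rw [← UniformSpace.Completion.coe_smul, ← UniformSpace.Completion.coe_smul,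
        ← UniformSpace.Completion.coe_add, ← UniformSpace.Completion.coe_sub,
        UniformSpace.Completion.norm_coe, hnorm]
      exact sizeSeminorm_comb hX x₀ x y ⟨t, h⟩
    · simp [h0]
    · have h1 : (t : ℝ) = 1 := by
        by_contra h1
        exact h ⟨lt_of_le_of_ne t.2.1 (Ne.symm h0), lt_of_le_of_ne t.2.2 h1⟩
      simp [h1]
  refine ⟨UniformSpace.Completion (X →₀ ℝ), inferInstance, inferInstance, inferInstance, j,
    hiso.injective, hiso.isClosedEmbedding.isClosed_range, ?_, hcomb, hdist, fun hs => ?_⟩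
  · rintro _ ⟨x, rfl⟩ _ ⟨y, rfl⟩ a b ha hb hab
    refine ⟨comb₂ ⟨a, ha, by linarith⟩ x y, ?_⟩
    obtain rfl : b = 1 - a := by linarith
    exact hcomb x y _
  · rw [← TopologicalSpace.isSeparable_univ_iff]
    have hr : TopologicalSpace.IsSeparable (Set.range j) :=
      TopologicalSpace.isSeparable_range hiso.continuous
    -- The span of `j(X)` contains every formal combination, hence is dense.
    refine (hr.span (R := ℝ)).closure.mono fun z _ => ?_
    refine closure_mono ?_ (UniformSpace.Completion.denseRange_coe (α := X →₀ ℝ) z)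
    rintro _ ⟨v, rfl⟩
    induction v using Finsupp.induction_linear with
    | zero => rw [UniformSpace.Completion.coe_zero]; exact zero_mem _
    | add v w hv hw => rw [UniformSpace.Completion.coe_add]; exact add_mem hv hw
    | single x s =>
      rw [← mul_one s, ← smul_eq_mul, ← Finsupp.smul_single, UniformSpace.Completion.coe_smul]
      exact Submodule.smul_mem _ s (Submodule.subset_span ⟨x, rfl⟩)
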